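/- Let $\varphi_k(t)=\sqrt{k+1/2}\,(2^kk!)^{-1}\frac{d^k}{dt^k}(t^2-1)^k$, $k=0,1,2,\dots$, be the Legendre polynomials orthonormal on $[-1,1]$, let $Q=[-1,1]^2$, and for $f\in L_2(Q)$ let $\langle f,\varphi_{k,j}\rangle=\int_{-1}^1\int_{-1}^1 f(t,\tau)\varphi_k(t)\varphi_j(\tau)\,d\tau\,dt$. Let $r\ge 1$ be an integer, $1\le s<\infty$, $1\le p\le\infty$ (with $1/\infty=0$), and $\mu>2r-\frac1s+\frac32$. Let $L^\mu_{s,2}$ be the class of all real $f\in L_2(Q)$ with $$\|f\|_{s,\mu}=\Big(\sum_{k,j=0}^\infty \max\{1,kj\}^{s\mu}\,|\langle f,\varphi_{k,j}\rangle|^s\Big)^{1/s}\le 1 .$$ For $f\in L^\mu_{s,2}$ let $$f^{(r,r)}(t,\tau)=\sum_{k,j=r}^\infty\langle f,\varphi_{k,j}\rangle\varphi_k^{(r)}(t)\varphi_j^{(r)}(\tau).$$ For an integer $n\ge 0$ and a double sequence of real numbers $\overline{f^\delta}=(f^\delta_{k,j})_{k,j\ge0}$ put $$\mathcal D_n^{(r,r)}f^\delta(t,\tau)=\sum_{k,j\ge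 r,\ kj\le rn-1} f^\delta_{k,j}\,\varphi_k^{(r)}(t)\varphi_j^{(r)}(\tau).$$ Then for every $f\in L^\mu_{s,2}$ the series defining $f^{(r,r)}$ converges unconditionally in $C(Q)$. Moreover, for all $a,b>0$ and $\delta_0\in(0,1)$ there is a constant $c>0$, depending only on $\mu,r,s,p,a,b,\delta_0$, such that the following holds. If $0<\delta\le\delta_0$, if the integer $n$ satisfies $$a\Big(\delta^{-1}\ln^{\frac1p-\frac1s}\tfrac1\delta\Big)^{\frac{1}{\mu-1/p+1/s}}\le n\le b\Big(\delta^{-1}\ln^{\frac1p-\frac1s}\tfrac1\delta\Big)^{\frac{1}{\mu-1/p+1/s}},$$ if $f\in L^\mu_{s,2}$, and if $\big\|(\langle f,\varphi_{k,j}\rangle-f^\delta_{k,j})_{k,j\ge 0}\big\|_{\ell_p}\le\delta$, then $$\big\|f^{(r,r)}-\mathcal D_n^{(r,r)}f^\delta\big\|_{C(Q)}\le c\,\Big(\delta\ln^{\frac1s-\frac1p}\tfrac1\delta\Big)^{\frac{\mu-2r+1/s-3/2}{\mu-1/p+1/s}}\ln^{2-\frac1s}\tfrac1\delta .$$ -/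

import Mathlib

open MeasureTheory
open scoped ENNReal Polynomial

noncomputable section

namespace LegendreDiff

/-- The orthonormal Legendre polynomial on `[-1,1]` (Rodrigues formula)
`φ_k = √(k + 1/2) (2^k k!)⁻¹ (d/dt)^k (t² - 1)^k`. -/
def phi (k : ℕ) : ℝ[X] :=
  Polynomial.C (Real.sqrt ((k : ℝ) + 1 / 2) * ((2 : ℝ) ^ k * (k.factorial : ℝ))⁻¹) *
    (Polynomial.derivative^[k] ((Polynomial.X ^ 2 - 1) ^ k))

/-- The square `Q = [-1,1]²` as a compact space. -/
abbrev Square : Type := Set.Icc (-1 : ℝ) 1 × Set.Icc (-1 : ℝ) 1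

/-- The square `Q = [-1,1]²` as a subset of the plane. -/
def squareSet : Set (ℝ × ℝ) := Set.Icc (-1 : ℝ) 1 ×ˢ Set.Icc (-1 : ℝ) 1

/-- The Fourier-Legendre coefficient
`⟨f, φ_{k,j}⟩ = ∫_{-1}^{1} ∫_{-1}^{1} f(t,τ) φ_k(t) φ_j(τ) dτ dt`. -/
def coeff (f : ℝ × ℝ → ℝ) (k j : ℕ) : ℝ :=
  ∫ t in (-1 : ℝ)..1, ∫ τ in (-1 : ℝ)..1, f (t, τ) * (phi k).eval t * (phi j).eval τ

/-- The summands `(max 1 (k j))^{s μ} |⟨f, φ_{k,j}⟩|^s` of `‖f‖_{s,μ}^s`. -/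
def normTerm (s μ : ℝ) (f : ℝ × ℝ → ℝ) (kj : ℕ × ℕ) : ℝ :=
  (max 1 ((kj.1 : ℝ) * (kj.2 : ℝ))) ^ (s * μ) * |coeff f kj.1 kj.2| ^ s

/-- The norm `‖f‖_{s,μ}` (meaningful when the defining series converges). -/
def smoothNorm (s μ : ℝ) (f : ℝ × ℝ → ℝ) : ℝ :=
  (∑' kj : ℕ × ℕ, normTerm s μ f kj) ^ (1 / s)

/-- The space `L^μ_{s,2}(Q)`. -/
def smoothSpace (s μ : ℝ) : Set (ℝ × ℝ → ℝ) :=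
  {f | MemLp f 2 (volume.restrict squareSet) ∧ Summable (normTerm s μ f)}

/-- The class `L^μ_{s,2}`: the unit ball of the space. -/
def smoothClass (s μ : ℝ) : Set (ℝ × ℝ → ℝ) :=
  {f | f ∈ smoothSpace s μ ∧ smoothNorm s μ f ≤ 1}

/-- The function `(t,τ) ↦ φ_k^{(r)}(t) φ_j^{(r)}(τ)` as an element of `C(Q)`. -/
def phiDeriv (r k j : ℕ) : C(Square, ℝ) where
  toFun x := (Polynomial.derivative^[r] (phi k)).eval (x.1 : ℝ) *
    (Polynomial.derivative^[r] (phi j)).eval (x.2 : ℝ)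
  continuous_toFun := by fun_prop

/-- The summands, over all `(k,j)` with `k, j ≥ r`, of the series that defines `f^{(r,r)}`. -/
def mixedDerivTerm (r : ℕ) (f : ℝ × ℝ → ℝ) (kj : Set.Ici (r, r)) : C(Square, ℝ) :=
  coeff f kj.1.1 kj.1.2 • phiDeriv r kj.1.1 kj.1.2

/-- The mixed derivative `f^{(r,r)} = ∑_{k,j ≥ r} ⟨f, φ_{k,j}⟩ φ_k^{(r)}(t) φ_j^{(r)}(τ)`, the sum
being taken in `C(Q)`, that is, uniformly on `Q`. -/
def mixedDeriv (r : ℕ) (f : ℝ × ℝ → ℝ) : C(Square, ℝ) :=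
  ∑' kj, mixedDerivTerm r f kj

/-- The hyperbolic cross `Γ_n = {(k,j) : k j ≤ r n - 1, r ≤ k, j ≤ n - 1}`. -/
def hyperbolicCross (r n : ℕ) : Finset (ℕ × ℕ) :=
  (Finset.Ico r n ×ˢ Finset.Ico r n).filter fun kj => kj.1 * kj.2 + 1 ≤ r * n

/-- The truncation method applied to a double sequence `g` of (perturbed) coefficients. -/
def truncation (r n : ℕ) (g : ℕ × ℕ → ℝ) : C(Square, ℝ) :=
  ∑ kj ∈ hyperbolicCross r n, g kj • phiDeriv r kj.1 kj.2

/-- `g` is a perturbation of the coefficients of `f` with error level `δ` in `ℓ_p`. -/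
def IsPerturbation (p : ℝ≥0∞) (δ : ℝ) (f : ℝ × ℝ → ℝ) (g : ℕ × ℕ → ℝ) : Prop :=
  ∃ ξ : lp (fun _ : ℕ × ℕ => ℝ) p, (∀ kj : ℕ × ℕ, ξ kj = coeff f kj.1 kj.2 - g kj) ∧ ‖ξ‖ ≤ δ

/-- The real number `1/p` for `1 ≤ p ≤ ∞`, with `1/∞ = 0`. -/
def recip (p : ℝ≥0∞) : ℝ := (1 / p).toReal

end LegendreDiff

end

/-! ### Legendre polynomials: recurrences, sup bound, Markov-type derivative bound. -/

namespace LegendreDiff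

/-! A Markov-type bound gives `‖phiDeriv r k j‖ ≤ 4 * (k j) ^ (2 r + 1/2)` (`norm_phiDeriv_le`), so
every estimate reduces to weighted sums of `|coeff f k j|` over `k j ≥ N` (truncation) and of the
noise over `k j < N`, where `N = r n`. The hyperbolic cross is never counted. Hölder's inequality is
applied on the whole lattice with weight `(k j) ^ (-(1 + ε))`, whose total mass is at most `(1 +
1/ε)²`, and the rest of the power of `k j` is bounded by its value at `N` (Rankin's trick). With `β
= μ - 2r + 1/s - 3/2` and `D = μ - 1/p + 1/s`, the two errors are at most `(1 + 1/ε)^(2(1-1/s))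
N^(-β + ε(1-1/s))` and `δ (1 + 1/ε)^(2(1-1/p)) N^(D-β + ε(1-1/p))`, up to the factor 4. Taking `ε`
of order `1 / log (1/δ)` keeps `N ^ ε` bounded and turns `1 + 1/ε` into a logarithm; the prescribed
size of `n` then yields the rate (`exists_rate_const`). -/

open Polynomial in
/-- The Legendre polynomial with the normalization `P_k(1) = 1`. -/
noncomputable def legendre (k : ℕ) : ℝ[X] :=
  C (((2 : ℝ) ^ k * (k.factorial : ℝ))⁻¹) * derivative^[k] ((X ^ 2 - 1) ^ k)

theorem phi_eq (k : ℕ) :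
    phi k = Polynomial.C (Real.sqrt ((k : ℝ) + 1 / 2)) * legendre k := by
  simp only [phi, legendre, map_mul, mul_assoc]

theorem legendre_zero : legendre 0 = 1 := by
  simp [legendre]

open Polynomial in
theorem derivative_legendre_succ (k : ℕ) :
    derivative (legendre (k + 1)) =
      X * derivative (legendre k) + C ((k : ℝ) + 1) * legendre k := by
  have h1 : derivative ((X ^ 2 - 1 : ℝ[X]) ^ (k + 1)) =
      C (2 * ((k : ℝ) + 1)) * ((X ^ 2 - 1) ^ k * X) := by
    rw [derivative_pow_succ]
    simp only [derivative_sub, derivative_X_pow, derivative_one, map_mul, map_add, map_natCast,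
      map_one, map_ofNat]
    push_cast
    ring
  have h2 : derivative^[k + 2] ((X ^ 2 - 1 : ℝ[X]) ^ (k + 1)) =
      C (2 * ((k : ℝ) + 1)) * (X * derivative^[k + 1] ((X ^ 2 - 1 : ℝ[X]) ^ k) +
        C ((k : ℝ) + 1) * derivative^[k] ((X ^ 2 - 1 : ℝ[X]) ^ k)) := by
    rw [Function.iterate_succ_apply, h1, iterate_derivative_C_mul, iterate_derivative_mul_X]
    simp only [nsmul_eq_mul, map_add, map_natCast, map_one, add_tsub_cancel_right]
    push_cast
    ring
  have h3 : (((2 : ℝ) ^ (k + 1) * ((k + 1).factorial : ℝ))⁻¹) * (2 * ((k : ℝ) + 1)) =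
      ((2 : ℝ) ^ k * (k.factorial : ℝ))⁻¹ := by
    have : (k.factorial : ℝ) ≠ 0 := by positivity
    rw [Nat.factorial_succ]
    push_cast
    field_simp
    ring
  simp only [legendre, derivative_C_mul, ← Function.iterate_succ_apply' derivative]
  rw [h2, ← mul_assoc, ← C_mul, h3]
  ring

-- Differentiate `(X² - 1)^(k+2)` twice and write `X² = (X² - 1) + 1`. The nonnegative coefficients
-- make this the recurrence for bounding derivatives by induction.
open Polynomial in
theorem derivative_legendre_add_two (k : ℕ) :
    derivative (legendre (k + 2)) =
      derivative (legendre k) + C (2 * (k : ℝ) + 3) * legendre (k + 1) := by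
  have h1 : derivative^[2] ((X ^ 2 - 1 : ℝ[X]) ^ (k + 2)) =
      C (2 * ((k : ℝ) + 2)) * (C (2 * (k : ℝ) + 3) * (X ^ 2 - 1) ^ (k + 1) +
        C (2 * ((k : ℝ) + 1)) * (X ^ 2 - 1) ^ k) := by
    change derivative (derivative ((X ^ 2 - 1 : ℝ[X]) ^ (k + 2))) = _
    rw [show k + 2 = (k + 1) + 1 from rfl, derivative_pow_succ]
    simp only [derivative_mul, derivative_pow_succ, derivative_sub,
      derivative_one, derivative_X, map_mul, map_add, map_natCast, map_one, map_ofNat]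
    push_cast
    simp
    ring
  have h2 : derivative^[k + 3] ((X ^ 2 - 1 : ℝ[X]) ^ (k + 2)) =
      C (2 * ((k : ℝ) + 2)) * (C (2 * (k : ℝ) + 3) *
          derivative^[k + 1] ((X ^ 2 - 1 : ℝ[X]) ^ (k + 1)) +
        C (2 * ((k : ℝ) + 1)) * derivative^[k + 1] ((X ^ 2 - 1 : ℝ[X]) ^ k)) := by
    rw [show k + 3 = (k + 1) + 2 from rfl, Function.iterate_add_apply derivative (k + 1) 2, h1]
    rw [iterate_derivative_C_mul, iterate_map_add, iterate_derivative_C_mul,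
      iterate_derivative_C_mul]
  have h3 : (((2 : ℝ) ^ (k + 2) * ((k + 2).factorial : ℝ))⁻¹) * (2 * ((k : ℝ) + 2)) =
      ((2 : ℝ) ^ (k + 1) * ((k + 1).factorial : ℝ))⁻¹ := by
    have : ((k + 1).factorial : ℝ) ≠ 0 := by positivity
    rw [Nat.factorial_succ (k + 1)]
    push_cast
    field_simp
    ring
  have h4 : (((2 : ℝ) ^ (k + 1) * ((k + 1).factorial : ℝ))⁻¹) * (2 * ((k : ℝ) + 1)) =
      ((2 : ℝ) ^ k * (k.factorial : ℝ))⁻¹ := by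
    have : (k.factorial : ℝ) ≠ 0 := by positivity
    rw [Nat.factorial_succ]
    push_cast
    field_simp
    ring
  simp only [legendre, derivative_C_mul, ← Function.iterate_succ_apply' derivative]
  rw [h2, ← mul_assoc, ← C_mul, h3, ← h4]
  simp only [map_mul, map_add, map_natCast, map_one, map_ofNat]
  ring

open Polynomial in
theorem derivative_legendre_eq (k : ℕ) :
    derivative (legendre k) =
      X * derivative (legendre (k + 1)) - C ((k : ℝ) + 1) * legendre (k + 1) := by
  have h1 := derivative_legendre_add_two k
  have h2 := derivative_legendre_succ (k + 1)
  rw [h2] at h1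
  simp only [map_mul, map_add, map_natCast, map_one, map_ofNat] at h1 ⊢
  push_cast at h1
  linear_combination -h1

-- Evaluated at `±1` this gives the endpoint values; differentiated, it gives Legendre's equation.
open Polynomial in
theorem one_sub_sq_mul_derivative_legendre (k : ℕ) :
    (1 - X ^ 2) * derivative (legendre (k + 1)) =
      C ((k : ℝ) + 1) * (legendre k - X * legendre (k + 1)) := by
  have h1 := derivative_legendre_eq k
  have h2 := derivative_legendre_succ k
  linear_combination X * h1 + h2

open Polynomial in
/-- Legendre's differential equation. -/
theorem legendre_ode (k : ℕ) :
    (1 - X ^ 2) * derivative (derivative (legendre (k + 1))) =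
      2 * X * derivative (legendre (k + 1)) -
        C (((k : ℝ) + 1) * ((k : ℝ) + 2)) * legendre (k + 1) := by
  have h := congrArg derivative (one_sub_sq_mul_derivative_legendre k)
  have h1 := derivative_legendre_eq k
  simp only [derivative_mul, derivative_sub, derivative_one, derivative_X_pow, derivative_X,
    derivative_C] at h
  rw [h1] at h
  simp only [map_mul, map_add, map_natCast, map_one, map_ofNat] at h ⊢
  norm_num at h
  linear_combination h

theorem legendre_eval_one (k : ℕ) : (legendre k).eval 1 = 1 := by
  induction k with
  | zero => simp [legendre_zero]
  | succ k ih =>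
    have h := congrArg (Polynomial.eval 1) (one_sub_sq_mul_derivative_legendre k)
    have hk : (k : ℝ) + 1 ≠ 0 := by positivity
    simp [ih, hk] at h
    linarith

theorem legendre_eval_neg_one_sq (k : ℕ) : (legendre k).eval (-1) ^ 2 = 1 := by
  induction k with
  | zero => simp [legendre_zero]
  | succ k ih =>
    have h := congrArg (Polynomial.eval (-1)) (one_sub_sq_mul_derivative_legendre k)
    have hk : (k : ℝ) + 1 ≠ 0 := by positivity
    simp [hk] at h
    rw [show (legendre (k + 1)).eval (-1) = -(legendre k).eval (-1) by linarith, neg_sq, ih]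

-- Sonin's argument: by the differential equation, `G = (k+1)(k+2) P² + (1 - X²) P'²` has derivative
-- `2 X P'²`. On `[-1,1]` it is therefore largest at the endpoints, where `P² = 1`.
open Polynomial in
theorem abs_legendre_le_one (k : ℕ) {x : ℝ} (hx : x ∈ Set.Icc (-1 : ℝ) 1) :
    |(legendre k).eval x| ≤ 1 := by
  cases k with
  | zero => simp [legendre_zero]
  | succ k =>
    set P := legendre (k + 1) with hP
    set G : ℝ[X] := C (((k : ℝ) + 1) * ((k : ℝ) + 2)) * P ^ 2 +
      (1 - X ^ 2) * derivative P ^ 2 with hG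
    have hG' : derivative G = 2 * X * derivative P ^ 2 := by
      have h := legendre_ode k
      rw [← hP] at h
      simp only [hG, derivative_add, derivative_mul, derivative_pow, derivative_sub, derivative_one,
        derivative_X, derivative_C, Nat.cast_ofNat, map_ofNat, Nat.add_one_sub_one, pow_one,
        mul_one, zero_mul, zero_add, zero_sub]
      linear_combination (2 * derivative P) * h
    have hd : ∀ y, deriv (fun y => G.eval y) y = 2 * y * (derivative P).eval y ^ 2 := by
      intro y
      rw [Polynomial.deriv, hG']
      simp
    have key : ∀ y, ((k : ℝ) + 1) * ((k : ℝ) + 2) * P.eval y ^ 2 +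
        (1 - y ^ 2) * (derivative P).eval y ^ 2 = G.eval y := by
      intro y; simp [hG]
    have hGx : G.eval x ≤ ((k : ℝ) + 1) * ((k : ℝ) + 2) := by
      rcases le_total 0 x with h0 | h0
      · have hm : MonotoneOn (fun y => G.eval y) (Set.Icc 0 1) := by
          refine monotoneOn_of_deriv_nonneg (convex_Icc 0 1) G.continuous.continuousOn
            G.differentiable.differentiableOn fun y hy => ?_
          rw [interior_Icc] at hy
          rw [hd]
          have := hy.1.le
          positivity
        have := hm ⟨h0, hx.2⟩ (Set.right_mem_Icc.2 zero_le_one) hx.2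
        refine this.trans (le_of_eq ?_)
        simp only [← key, hP, legendre_eval_one]
        ring
      · have hm : AntitoneOn (fun y => G.eval y) (Set.Icc (-1) 0) := by
          refine antitoneOn_of_deriv_nonpos (convex_Icc (-1) 0) G.continuous.continuousOn
            G.differentiable.differentiableOn fun y hy => ?_
          rw [interior_Icc] at hy
          rw [hd]
          exact mul_nonpos_of_nonpos_of_nonneg (by linarith [hy.2]) (sq_nonneg _)
        have := hm (Set.left_mem_Icc.2 (by norm_num)) ⟨hx.1, h0⟩ hx.1
        refine this.trans (le_of_eq ?_)
        simp only [← key, hP, legendre_eval_neg_one_sq]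
        ring
    have h2 : 0 ≤ (1 - x ^ 2) * (derivative P).eval x ^ 2 :=
      mul_nonneg (by nlinarith [hx.1, hx.2]) (sq_nonneg _)
    have h3 : 0 < ((k : ℝ) + 1) * ((k : ℝ) + 2) := by positivity
    rw [← sq_le_one_iff_abs_le_one]
    have := key x
    by_contra! hc
    nlinarith

open Polynomial in
/-- The Markov-type bound for the derivatives of the Legendre polynomials. -/
theorem abs_iterate_derivative_legendre_le (r k : ℕ) {x : ℝ} (hx : x ∈ Set.Icc (-1 : ℝ) 1) :
    |(derivative^[r] (legendre k)).eval x| ≤ (k : ℝ) ^ (2 * r) := by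
  induction r generalizing k with
  | zero => simpa using abs_legendre_le_one k hx
  | succ r ih =>
    induction k using Nat.twoStepInduction with
    | zero =>
      rw [legendre_zero, iterate_derivative_one (by omega)]
      simp
    | one =>
      rw [Function.iterate_succ_apply, derivative_legendre_succ 0, legendre_zero]
      have h := ih 0
      rw [legendre_zero] at h
      simp only [derivative_one, mul_zero, zero_add, CharP.cast_eq_zero, map_one, mul_one,
        Nat.cast_one, one_pow]
      refine h.trans ?_
      rcases Nat.eq_zero_or_pos r with rfl | hr
      · simp
      · simp [hr.ne']
    | more k h1 _ =>
      rw [Function.iterate_succ_apply, derivative_legendre_add_two, iterate_map_add,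
        iterate_derivative_C_mul, ← Function.iterate_succ_apply]
      rw [eval_add, eval_mul, eval_C]
      have h2 := ih (k + 1)
      have h3 : (k : ℝ) ^ (2 * r) ≤ ((k : ℝ) + 2) ^ (2 * r) := by gcongr; linarith
      have h4 : ((k : ℝ) + 1) ^ (2 * r) ≤ ((k : ℝ) + 2) ^ (2 * r) := by gcongr; linarith
      have h5 : (0 : ℝ) ≤ 2 * k + 3 := by positivity
      push_cast at h2 ⊢
      calc _ ≤ |(derivative^[r + 1] (legendre k)).eval x| +
            (2 * (k : ℝ) + 3) * |(derivative^[r] (legendre (k + 1))).eval x| := by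
            refine (abs_add_le _ _).trans ?_
            rw [abs_mul, abs_of_nonneg h5]
        _ ≤ (k : ℝ) ^ (2 * (r + 1)) + (2 * (k : ℝ) + 3) * ((k : ℝ) + 1) ^ (2 * r) := by
            gcongr
        _ = (k : ℝ) ^ 2 * (k : ℝ) ^ (2 * r) + (2 * (k : ℝ) + 3) * ((k : ℝ) + 1) ^ (2 * r) := by
            ring
        _ ≤ (k : ℝ) ^ 2 * ((k : ℝ) + 2) ^ (2 * r) +
            (2 * (k : ℝ) + 3) * ((k : ℝ) + 2) ^ (2 * r) := by gcongr
        -- The induction closes because `k² + 2k + 3 ≤ (k + 2)²`.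
        _ ≤ ((k : ℝ) + 2) ^ 2 * ((k : ℝ) + 2) ^ (2 * r) := by
            rw [← add_mul]
            gcongr
            nlinarith [(Nat.cast_nonneg k : (0 : ℝ) ≤ k)]
        _ = _ := by ring

open Polynomial in
theorem abs_iterate_derivative_phi_le (r : ℕ) {k : ℕ} (hk : 1 ≤ k) {x : ℝ}
    (hx : x ∈ Set.Icc (-1 : ℝ) 1) :
    |(derivative^[r] (phi k)).eval x| ≤ 2 * (k : ℝ) ^ (2 * (r : ℝ) + 1 / 2) := by
  have hk' : (1 : ℝ) ≤ k := by exact_mod_cast hk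
  rw [phi_eq, iterate_derivative_C_mul, eval_mul, eval_C, abs_mul,
    abs_of_nonneg (Real.sqrt_nonneg _)]
  have h1 : Real.sqrt ((k : ℝ) + 1 / 2) ≤ 2 * (k : ℝ) ^ (1 / 2 : ℝ) := by
    rw [← Real.sqrt_eq_rpow]
    refine Real.sqrt_le_iff.2 ⟨by positivity, ?_⟩
    rw [mul_pow, Real.sq_sqrt (by linarith)]
    linarith
  calc _ ≤ (2 * (k : ℝ) ^ (1 / 2 : ℝ)) * (k : ℝ) ^ (2 * r) := by
        gcongr
        exact abs_iterate_derivative_legendre_le r k hx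
    _ = _ := by
        rw [add_comm, Real.rpow_add (by linarith), mul_assoc]
        congr 2
        exact_mod_cast (Real.rpow_natCast (k : ℝ) (2 * r)).symm

theorem norm_phiDeriv_le (r : ℕ) {k j : ℕ} (hk : 1 ≤ k) (hj : 1 ≤ j) :
    ‖phiDeriv r k j‖ ≤ 4 * ((k : ℝ) * (j : ℝ)) ^ (2 * (r : ℝ) + 1 / 2) := by
  refine (ContinuousMap.norm_le _ (by positivity)).2 fun x => ?_
  simp only [phiDeriv, ContinuousMap.coe_mk, norm_mul, Real.norm_eq_abs]
  calc _ ≤ (2 * (k : ℝ) ^ (2 * (r : ℝ) + 1 / 2)) * (2 * (j : ℝ) ^ (2 * (r : ℝ) + 1 / 2)) := by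
        gcongr
        · exact abs_iterate_derivative_phi_le r hk x.1.2
        · exact abs_iterate_derivative_phi_le r hj x.2.2
    _ = _ := by
        rw [Real.mul_rpow (by positivity) (by positivity)]
        ring

end LegendreDiff

/-! ### Weighted Hölder estimates on the lattice of index pairs. -/

namespace LegendreDiff

/-- A discrete substitute for integrating `ε t^(-1-ε)` over `[x, x+1]`, making the sum below
telescope; it follows from two uses of `1 + y ≤ exp y`. -/
theorem mul_add_one_rpow_le {ε x : ℝ} (hε : 0 < ε) (hx : 0 < x) :
    ε * (x + 1) ^ (-(1 + ε)) ≤ x ^ (-ε) - (x + 1) ^ (-ε) := by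
  have hx1 : 0 < x + 1 := by linarith
  have h1 : x ≤ (x + 1) * Real.exp (-(1 / (x + 1))) := by
    have := Real.add_one_le_exp (-(1 / (x + 1)))
    calc x = (x + 1) * (-(1 / (x + 1)) + 1) := by field_simp; ring
      _ ≤ _ := by gcongr
  have h2 : (x + 1) ^ (-ε) * (ε / (x + 1) + 1) ≤ x ^ (-ε) := by
    calc _ ≤ (x + 1) ^ (-ε) * Real.exp (ε / (x + 1)) := by
          gcongr
          exact Real.add_one_le_exp _
      _ = ((x + 1) * Real.exp (-(1 / (x + 1)))) ^ (-ε) := by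
          rw [Real.mul_rpow hx1.le (Real.exp_pos _).le, ← Real.exp_mul]
          congr 2
          field_simp
      _ ≤ _ := Real.rpow_le_rpow_of_nonpos hx h1 (by linarith)
  have h3 : (x + 1) ^ (-(1 + ε)) = (x + 1) ^ (-ε) / (x + 1) := by
    rw [show -(1 + ε) = -ε - 1 by ring, Real.rpow_sub_one hx1.ne']
  rw [h3]
  calc _ = (x + 1) ^ (-ε) * (ε / (x + 1) + 1) - (x + 1) ^ (-ε) := by ring
    _ ≤ _ := by linarith

theorem sum_Ico_rpow_le {ε : ℝ} (hε : 0 < ε) (K : ℕ) :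
    ∑ k ∈ Finset.Ico 1 K, (k : ℝ) ^ (-(1 + ε)) ≤ 1 + 1 / ε := by
  -- The subtracted remainder makes the induction telescope; at `n = 0` both sides equal 1.
  have key : ∀ n : ℕ, ∑ k ∈ Finset.Ico 1 (n + 2), (k : ℝ) ^ (-(1 + ε)) ≤
      1 + 1 / ε - ((n : ℝ) + 1) ^ (-ε) / ε := by
    intro n
    induction n with
    | zero => simp
    | succ n ih =>
      rw [Finset.sum_Ico_succ_top (by omega)]
      have h := mul_add_one_rpow_le hε (x := (n : ℝ) + 1) (by positivity)
      rw [← le_div_iff₀' hε, sub_div] at h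
      push_cast
      rw [show (n : ℝ) + 2 = n + 1 + 1 by ring]
      linarith
  calc _ ≤ ∑ k ∈ Finset.Ico 1 (K + 2), (k : ℝ) ^ (-(1 + ε)) := by
        refine Finset.sum_le_sum_of_subset_of_nonneg (Finset.Ico_subset_Ico_right (by omega)) ?_
        intros; positivity
    _ ≤ _ := key K
    _ ≤ _ := by
        have : 0 ≤ ((K : ℝ) + 1) ^ (-ε) / ε := by positivity
        linarith

/-- The product `k j` of an index pair, as a real number. -/
def indexProd (i : ℕ × ℕ) : ℝ := (i.1 : ℝ) * (i.2 : ℝ)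

theorem indexProd_nonneg (i : ℕ × ℕ) : 0 ≤ indexProd i := by
  unfold indexProd; positivity

theorem one_le_indexProd {i : ℕ × ℕ} (h1 : 1 ≤ i.1) (h2 : 1 ≤ i.2) : 1 ≤ indexProd i := by
  have h : 1 ≤ i.1 * i.2 := Nat.mul_pos h1 h2
  unfold indexProd
  exact_mod_cast h

theorem sum_indexProd_rpow_le {ε : ℝ} (hε : 0 < ε) (S : Finset (ℕ × ℕ))
    (hS : ∀ i ∈ S, 1 ≤ i.1 ∧ 1 ≤ i.2) :
    ∑ i ∈ S, indexProd i ^ (-(1 + ε)) ≤ (1 + 1 / ε) ^ 2 := by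
  obtain ⟨K, hK⟩ : ∃ K : ℕ, ∀ i ∈ S, i.1 < K ∧ i.2 < K := by
    refine ⟨S.sup (fun i => i.1 + i.2) + 1, fun i hi => ?_⟩
    have := Finset.le_sup (f := fun i : ℕ × ℕ => i.1 + i.2) hi
    omega
  calc _ ≤ ∑ i ∈ Finset.Ico 1 K ×ˢ Finset.Ico 1 K, indexProd i ^ (-(1 + ε)) := by
        refine Finset.sum_le_sum_of_subset_of_nonneg (fun i hi => ?_) fun i _ _ =>
          Real.rpow_nonneg (indexProd_nonneg i) _
        simp only [Finset.mem_product, Finset.mem_Ico]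
        exact ⟨⟨(hS i hi).1, (hK i hi).1⟩, ⟨(hS i hi).2, (hK i hi).2⟩⟩
    _ = (∑ k ∈ Finset.Ico 1 K, (k : ℝ) ^ (-(1 + ε))) ^ 2 := by
        rw [sq, Finset.sum_mul_sum, Finset.sum_product]
        refine Finset.sum_congr rfl fun k _ => Finset.sum_congr rfl fun j _ => ?_
        rw [indexProd, Real.mul_rpow (by positivity) (by positivity)]
    _ ≤ _ := by
        gcongr
        exact sum_Ico_rpow_le hε K

/-- Hölder's inequality on the hyperbolic lattice, with the summable weight `(k j)^{-(1+ε)}`. -/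
theorem sum_indexProd_mul_le {ε q α M D : ℝ} (hε : 0 < ε) (hq : 1 ≤ q) (hM : 0 ≤ M) (hD : 0 ≤ D)
    (S : Finset (ℕ × ℕ)) (hS : ∀ i ∈ S, 1 ≤ i.1 ∧ 1 ≤ i.2) (x y : ℕ × ℕ → ℝ) (hx : ∀ i, 0 ≤ x i)
    (hxy : ∀ i ∈ S, indexProd i ^ ((1 + ε) * (q - 1) + q * α) * x i ^ q ≤ M ^ q * y i)
    (hy : ∑ i ∈ S, y i ≤ D ^ q) :
    ∑ i ∈ S, indexProd i ^ α * x i ≤ ((1 + 1 / ε) ^ 2) ^ (1 - 1 / q) * (M * D) := by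
  have hq0 : 0 < q := by linarith
  have hpos : ∀ i ∈ S, 0 < indexProd i := fun i hi =>
    zero_lt_one.trans_le (one_le_indexProd (hS i hi).1 (hS i hi).2)
  -- The exponent in `hxy` is `-(1 + ε) + q (1 + ε + α)`: the weight times the `q`-th power of the
  -- compensating factor.
  have h := Real.inner_le_weight_mul_Lp_of_nonneg S hq (fun i => indexProd i ^ (-(1 + ε)))
    (fun i => indexProd i ^ (1 + ε + α) * x i)
    (fun i => Real.rpow_nonneg (indexProd_nonneg i) _)
    (fun i => mul_nonneg (Real.rpow_nonneg (indexProd_nonneg i) _) (hx i))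
  have h1 : ∑ i ∈ S, indexProd i ^ α * x i =
      ∑ i ∈ S, indexProd i ^ (-(1 + ε)) * (indexProd i ^ (1 + ε + α) * x i) := by
    refine Finset.sum_congr rfl fun i hi => ?_
    rw [← mul_assoc, ← Real.rpow_add (hpos i hi)]
    congr 2
    ring
  have h2 : ∑ i ∈ S, indexProd i ^ (-(1 + ε)) * (indexProd i ^ (1 + ε + α) * x i) ^ q ≤
      (M * D) ^ q := by
    calc _ = ∑ i ∈ S, indexProd i ^ ((1 + ε) * (q - 1) + q * α) * x i ^ q := by
          refine Finset.sum_congr rfl fun i hi => ?_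
          rw [Real.mul_rpow (Real.rpow_nonneg (indexProd_nonneg i) _) (hx i),
            ← Real.rpow_mul (indexProd_nonneg i), ← mul_assoc, ← Real.rpow_add (hpos i hi)]
          congr 2
          ring
      _ ≤ ∑ i ∈ S, M ^ q * y i := Finset.sum_le_sum hxy
      _ = M ^ q * ∑ i ∈ S, y i := by rw [Finset.mul_sum]
      _ ≤ M ^ q * D ^ q := by gcongr
      _ = _ := (Real.mul_rpow hM hD).symm
  rw [h1]
  refine h.trans ?_
  rw [one_div q]
  have h3 : 0 ≤ ∑ i ∈ S, indexProd i ^ (-(1 + ε)) * (indexProd i ^ (1 + ε + α) * x i) ^ q :=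
    Finset.sum_nonneg fun i _ => mul_nonneg (Real.rpow_nonneg (indexProd_nonneg i) _)
      (Real.rpow_nonneg (mul_nonneg (Real.rpow_nonneg (indexProd_nonneg i) _) (hx i)) _)
  have h4 : 0 ≤ 1 - q⁻¹ := sub_nonneg.2 (inv_le_one_of_one_le₀ hq)
  refine mul_le_mul ?_ ?_ (Real.rpow_nonneg h3 _) (by positivity)
  · refine Real.rpow_le_rpow (Finset.sum_nonneg fun i _ => Real.rpow_nonneg (indexProd_nonneg i) _)
      ?_ h4
    exact sum_indexProd_rpow_le hε S hS
  · calc _ ≤ ((M * D) ^ q) ^ q⁻¹ := by gcongr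
      _ = _ := Real.rpow_rpow_inv (mul_nonneg hM hD) hq0.ne'

theorem sum_normTerm_le_one {s μ : ℝ} (hs : 1 ≤ s) {f : ℝ × ℝ → ℝ} (hf : f ∈ smoothClass s μ)
    (S : Finset (ℕ × ℕ)) : ∑ i ∈ S, normTerm s μ f i ≤ 1 := by
  have h0 : ∀ i, 0 ≤ normTerm s μ f i := fun i => by unfold normTerm; positivity
  refine (hf.1.2.sum_le_tsum S fun i _ => h0 i).trans ?_
  have h := hf.2
  unfold smoothNorm at h
  by_contra! hc
  exact absurd h (not_le.2 (Real.one_lt_rpow hc (by positivity)))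

/-- Once the class norm has absorbed `(k j)^(s μ)`, the remaining exponent is nonpositive because `ε
≤ μ - α - 1 + 1/s`, so the worst case is `k j = N`. -/
theorem sum_indexProd_mul_coeff_le {s μ ε α N : ℝ} (hs : 1 ≤ s) (hε : 0 < ε)
    (hεβ : ε ≤ μ - α - 1 + 1 / s) (hN : 0 < N) {f : ℝ × ℝ → ℝ} (hf : f ∈ smoothClass s μ)
    (S : Finset (ℕ × ℕ)) (hS : ∀ i ∈ S, 1 ≤ i.1 ∧ 1 ≤ i.2) (hSN : ∀ i ∈ S, N ≤ indexProd i) :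
    ∑ i ∈ S, indexProd i ^ α * |coeff f i.1 i.2| ≤
      ((1 + 1 / ε) ^ 2) ^ (1 - 1 / s) * N ^ (-(μ - α - 1 + 1 / s) + ε * (1 - 1 / s)) := by
  have hs0 : 0 < s := by linarith
  have hs1 : 0 < 1 / s := by positivity
  have h := sum_indexProd_mul_le (q := s) (α := α)
    (M := N ^ (-(μ - α - 1 + 1 / s) + ε * (1 - 1 / s))) (D := 1) hε hs (by positivity) zero_le_one
    S hS (fun i => |coeff f i.1 i.2|) (normTerm s μ f) (fun i => abs_nonneg _) ?_
    (by simpa using sum_normTerm_le_one hs hf S)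
  · simpa using h
  intro i hi
  have hp := one_le_indexProd (hS i hi).1 (hS i hi).2
  have hp0 : 0 < indexProd i := by linarith
  rw [normTerm, show (i.1 : ℝ) * (i.2 : ℝ) = indexProd i from rfl, max_eq_right hp, ← mul_assoc]
  refine mul_le_mul_of_nonneg_right ?_ (by positivity)
  have he : (1 + ε) * (s - 1) + s * α =
      (-(μ - α - 1 + 1 / s) + ε * (1 - 1 / s)) * s + s * μ := by
    field_simp
    ring
  rw [he, Real.rpow_add hp0, Real.rpow_mul hp0.le]
  have hs2 : 0 ≤ 1 / s := hs1.le
  have he0 : -(μ - α - 1 + 1 / s) + ε * (1 - 1 / s) ≤ 0 := by nlinarith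
  gcongr ?_ ^ _ * _
  exact Real.rpow_le_rpow_of_nonpos hN (hSN i hi) he0

/-- Here the remaining exponent is nonnegative, so `N` bounds from above. For `p = ∞` the pointwise
bound `|ξ i| ≤ δ` replaces Hölder. -/
theorem sum_indexProd_mul_perturbation_le {p : ℝ≥0∞} (hp : 1 ≤ p) {δ ε α N : ℝ} (hδ : 0 ≤ δ)
    (hε : 0 < ε) (hα : 0 ≤ α) (hN : 0 < N) (ξ : lp (fun _ : ℕ × ℕ => ℝ) p) (hξ : ‖ξ‖ ≤ δ)
    (S : Finset (ℕ × ℕ)) (hS : ∀ i ∈ S, 1 ≤ i.1 ∧ 1 ≤ i.2) (hSN : ∀ i ∈ S, indexProd i ≤ N) :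
    ∑ i ∈ S, indexProd i ^ α * |ξ i| ≤
      δ * ((1 + 1 / ε) ^ 2) ^ (1 - recip p) * N ^ (α + (1 + ε) * (1 - recip p)) := by
  have hpos : ∀ i ∈ S, 0 < indexProd i := fun i hi =>
    zero_lt_one.trans_le (one_le_indexProd (hS i hi).1 (hS i hi).2)
  rcases eq_or_ne p ∞ with rfl | hpt
  · have hr : recip ∞ = 0 := by simp [recip]
    rw [hr, sub_zero, Real.rpow_one, mul_one]
    calc _ ≤ ∑ i ∈ S, (δ * N ^ (α + (1 + ε))) * indexProd i ^ (-(1 + ε)) := by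
          refine Finset.sum_le_sum fun i hi => ?_
          have h1 : |ξ i| ≤ δ := (lp.norm_apply_le_norm (by simp) ξ i).trans hξ
          calc _ = indexProd i ^ (α + (1 + ε)) * indexProd i ^ (-(1 + ε)) * |ξ i| := by
                rw [← Real.rpow_add (hpos i hi)]
                congr 2
                ring
            _ ≤ N ^ (α + (1 + ε)) * indexProd i ^ (-(1 + ε)) * δ := by
                have := (hpos i hi).le
                gcongr
                exact hSN i hi
            _ = _ := by ring
      _ ≤ (δ * N ^ (α + (1 + ε))) * (1 + 1 / ε) ^ 2 := by
          rw [← Finset.mul_sum]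
          gcongr
          exact sum_indexProd_rpow_le hε S hS
      _ = _ := by ring
  · have hq : 1 ≤ p.toReal := by
      simpa using ENNReal.toReal_mono hpt hp
    have hq0 : 0 < p.toReal := by linarith
    have hr : recip p = 1 / p.toReal := by simp [recip]
    have hr1 : 1 / p.toReal ≤ 1 := by
      rw [div_le_one hq0]; exact hq
    rw [hr]
    have h := sum_indexProd_mul_le (q := p.toReal) (α := α)
      (M := N ^ (α + (1 + ε) * (1 - 1 / p.toReal))) (D := δ) hε hq (by positivity) hδ
      S hS (fun i => |ξ i|) (fun i => |ξ i| ^ p.toReal) (fun i => abs_nonneg _) ?_ ?_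
    · refine h.trans (le_of_eq ?_)
      ring
    · intro i hi
      refine mul_le_mul_of_nonneg_right ?_ (by positivity)
      have he : (1 + ε) * (p.toReal - 1) + p.toReal * α =
          (α + (1 + ε) * (1 - 1 / p.toReal)) * p.toReal := by
        field_simp
        ring
      rw [he, ← Real.rpow_mul hN.le]
      refine Real.rpow_le_rpow (hpos i hi).le (hSN i hi) (mul_nonneg ?_ hq0.le)
      have : 0 ≤ 1 - 1 / p.toReal := by linarith
      positivity
    · refine (lp.sum_rpow_le_norm_rpow hq0 ξ S).trans ?_
      gcongr
      exact lp.norm_nonneg' ξ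

end LegendreDiff

/-! ### Balancing truncation against noise. -/

namespace LegendreDiff

/-- The choice of the Rankin exponent `ε ≍ 1 / log(1/δ)` that balances truncation and noise. -/
theorem exists_rate_const {D β σ π a b δ₀ : ℝ} (hβ : 0 < β) (hβD : β ≤ D) (hσ0 : 0 ≤ σ)
    (hσ1 : σ ≤ 1) (hπ0 : 0 ≤ π) (hπ1 : π ≤ 1) (ha : 0 < a) (hb : 0 < b) (hδ₀ : 0 < δ₀)
    (hδ₀' : δ₀ < 1) :
    ∃ c : ℝ, 0 < c ∧ ∀ δ : ℝ, 0 < δ → δ ≤ δ₀ → ∀ N : ℝ, 1 ≤ N →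
      a * (δ⁻¹ * Real.log (1 / δ) ^ (π - σ)) ^ (1 / D) ≤ N →
      N ≤ b * (δ⁻¹ * Real.log (1 / δ) ^ (π - σ)) ^ (1 / D) →
      ∃ ε : ℝ, 0 < ε ∧ ε ≤ β ∧
        ((1 + 1 / ε) ^ 2) ^ (1 - σ) * N ^ (-β + ε * (1 - σ)) +
          δ * ((1 + 1 / ε) ^ 2) ^ (1 - π) * N ^ (D - β + ε * (1 - π)) ≤
        c * (δ * Real.log (1 / δ) ^ (σ - π)) ^ (β / D) * Real.log (1 / δ) ^ (2 - σ) := by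
  have hD : 0 < D := hβ.trans_le hβD
  set l₀ := Real.log (1 / δ₀) with hl₀
  have hl₀pos : 0 < l₀ := Real.log_pos (by rw [lt_div_iff₀ hδ₀]; linarith)
  -- With `ε = κ / (1 + l)`, `κ ≤ β` ensures `ε ≤ β`. The constants `A` and `B` are made for `log N
  -- ≤ A (1 + l)` and `1 + 1/ε ≤ B l`.
  set κ := min β 1 with hκ
  have hκpos : 0 < κ := lt_min hβ one_pos
  set A := |Real.log b| + (2 + 1 / l₀) / D with hA
  have hApos : 0 ≤ A := by positivity
  set B := (1 + 1 / κ) / l₀ + 1 / κ with hB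
  have hBpos : 0 < B := by positivity
  refine ⟨(B ^ 2) ^ (1 - σ) * a ^ (-β) * Real.exp A * l₀ ^ (-σ) +
    (B ^ 2) ^ (1 - π) * b ^ (D - β) * Real.exp A * l₀ ^ (-π), by positivity, ?_⟩
  intro δ hδ hδδ N hN1 haN hNb
  set l := Real.log (1 / δ) with hl
  have hll : l₀ ≤ l := Real.log_le_log (by positivity) (one_div_le_one_div_of_le hδ hδδ)
  have hlpos : 0 < l := hl₀pos.trans_le hll
  set Y := δ⁻¹ * l ^ (π - σ) with hY
  have hYpos : 0 < Y := by positivity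
  set u := Y ^ (1 / D) with hu
  have hupos : 0 < u := by positivity
  have hNpos : 0 < N := by linarith
  have hlogδ : Real.log δ⁻¹ = l := by rw [hl, one_div]
  -- The term `1 / l₀` covers `l < 1`, where `log l` is negative.
  have hlogl : |Real.log l| ≤ l + 1 / l₀ := by
    rw [abs_le]
    constructor
    · have h1 := Real.log_le_self (inv_pos.2 hlpos).le
      rw [Real.log_inv] at h1
      have h2 : l⁻¹ ≤ 1 / l₀ := by rw [one_div]; exact inv_anti₀ hl₀pos hll
      linarith
    · have h1 := Real.log_le_self hlpos.le
      have : 0 < 1 / l₀ := by positivity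
      linarith
  have hlogu : Real.log u ≤ (2 * l + 1 / l₀) / D := by
    rw [hu, Real.log_rpow hYpos, hY, Real.log_mul (by positivity) (by positivity),
      Real.log_rpow hlpos, hlogδ, one_div D, inv_mul_eq_div]
    refine div_le_div_of_nonneg_right ?_ hD.le
    have h1 : (π - σ) * Real.log l ≤ 1 * |Real.log l| := by
      refine (le_abs_self _).trans ?_
      rw [abs_mul]
      gcongr
      rw [abs_le]
      constructor <;> linarith
    linarith
  have hlogN : Real.log N ≤ A * (1 + l) := by
    calc Real.log N ≤ Real.log (b * u) := Real.log_le_log hNpos hNb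
      _ = Real.log b + Real.log u := Real.log_mul hb.ne' hupos.ne'
      _ ≤ |Real.log b| + (2 * l + 1 / l₀) / D := add_le_add (le_abs_self _) hlogu
      _ ≤ |Real.log b| * (1 + l) + (2 + 1 / l₀) / D * (1 + l) := by
          refine add_le_add (le_mul_of_one_le_right (abs_nonneg _) (by linarith)) ?_
          rw [div_mul_eq_mul_div]
          gcongr
          have : 0 < 1 / l₀ * l := by positivity
          nlinarith
      _ = _ := by rw [hA]; ring
  have hε : 0 < κ / (1 + l) := by positivity
  refine ⟨κ / (1 + l), hε, ?_, ?_⟩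
  · calc κ / (1 + l) ≤ κ := div_le_self hκpos.le (by linarith)
      _ ≤ β := min_le_left _ _
  set ε := κ / (1 + l) with hεdef
  have hNε : ∀ t : ℝ, 0 ≤ t → t ≤ 1 → N ^ (ε * t) ≤ Real.exp A := by
    intro t ht0 ht1
    rw [Real.rpow_def_of_pos hNpos, Real.exp_le_exp]
    calc Real.log N * (ε * t) ≤ A * (1 + l) * (ε * t) := by gcongr
      _ = A * (κ * t) := by rw [hεdef]; field_simp
      _ ≤ A * (1 * 1) := by
          gcongr
          exact min_le_right _ _
      _ = A := by ring
  have hZ : ∀ t : ℝ, t ≤ 1 →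
      ((1 + 1 / ε) ^ 2) ^ (1 - t) ≤ (B ^ 2) ^ (1 - t) * l ^ (2 - 2 * t) := by
    intro t ht
    have h1 : 1 + 1 / ε ≤ B * l := by
      have h2 : (1 + 1 / κ) * 1 ≤ (1 + 1 / κ) * (l / l₀) := by
        gcongr
        rwa [one_le_div hl₀pos]
      calc 1 + 1 / ε = (1 + 1 / κ) * 1 + 1 / κ * l := by rw [hεdef]; field_simp; ring
        _ ≤ (1 + 1 / κ) * (l / l₀) + 1 / κ * l := by gcongr
        _ = B * l := by rw [hB]; ring
    calc _ ≤ ((B * l) ^ 2) ^ (1 - t) :=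
          Real.rpow_le_rpow (by positivity) (by gcongr) (by linarith)
      _ = _ := by
          rw [mul_pow, Real.mul_rpow (by positivity) (by positivity)]
          congr 1
          rw [← Real.rpow_natCast, ← Real.rpow_mul hlpos.le]
          congr 1
          push_cast
          ring
  have hV : u ^ (-β) = (δ * l ^ (σ - π)) ^ (β / D) := by
    have h1 : δ * l ^ (σ - π) = Y⁻¹ := by
      rw [hY, mul_inv, inv_inv, ← Real.rpow_neg hlpos.le, neg_sub]
    rw [h1, hu, ← Real.rpow_mul hYpos.le, Real.inv_rpow hYpos.le, ← Real.rpow_neg hYpos.le]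
    congr 1
    ring
  have huD : δ * u ^ D = l ^ (π - σ) := by
    rw [hu, ← Real.rpow_mul hYpos.le, one_div_mul_cancel hD.ne', Real.rpow_one, hY]
    field_simp
  have hlneg : ∀ t : ℝ, 0 ≤ t → l ^ (-t) ≤ l₀ ^ (-t) := fun t ht =>
    Real.rpow_le_rpow_of_nonpos hl₀pos hll (by linarith)
  rw [← hV]
  -- The argument produces `l^(2 - 2σ)` here and `l^(2 - π - σ)` in `T2`; the surplus factors
  -- `l^(-σ)` and `l^(-π)` are bounded through `l ≥ l₀`.
  have T1 : ((1 + 1 / ε) ^ 2) ^ (1 - σ) * N ^ (-β + ε * (1 - σ)) ≤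
      (B ^ 2) ^ (1 - σ) * a ^ (-β) * Real.exp A * l₀ ^ (-σ) * u ^ (-β) * l ^ (2 - σ) := by
    rw [Real.rpow_add hNpos]
    have hN2 : N ^ (-β) ≤ a ^ (-β) * u ^ (-β) := by
      rw [← Real.mul_rpow ha.le hupos.le]
      exact Real.rpow_le_rpow_of_nonpos (by positivity) haN (by linarith)
    calc _ ≤ ((B ^ 2) ^ (1 - σ) * l ^ (2 - 2 * σ)) * ((a ^ (-β) * u ^ (-β)) * Real.exp A) := by
          gcongr
          · exact hZ σ hσ1
          · exact hNε (1 - σ) (by linarith) (by linarith)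
      _ = (B ^ 2) ^ (1 - σ) * a ^ (-β) * Real.exp A * l ^ (-σ) * u ^ (-β) * l ^ (2 - σ) := by
          rw [show 2 - 2 * σ = -σ + (2 - σ) by ring, Real.rpow_add hlpos]
          ring
      _ ≤ _ := by
          refine mul_le_mul_of_nonneg_right (mul_le_mul_of_nonneg_right
            (mul_le_mul_of_nonneg_left (hlneg σ hσ0) ?_) ?_) ?_ <;> positivity
  have T2 : δ * ((1 + 1 / ε) ^ 2) ^ (1 - π) * N ^ (D - β + ε * (1 - π)) ≤
      (B ^ 2) ^ (1 - π) * b ^ (D - β) * Real.exp A * l₀ ^ (-π) * u ^ (-β) * l ^ (2 - σ) := by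
    rw [Real.rpow_add hNpos]
    have hN2 : N ^ (D - β) ≤ b ^ (D - β) * u ^ (D - β) := by
      rw [← Real.mul_rpow hb.le hupos.le]
      exact Real.rpow_le_rpow hNpos.le hNb (by linarith)
    calc _ ≤ δ * ((B ^ 2) ^ (1 - π) * l ^ (2 - 2 * π)) *
            ((b ^ (D - β) * u ^ (D - β)) * Real.exp A) := by
          gcongr
          · exact hZ π hπ1
          · exact hNε (1 - π) (by linarith) (by linarith)
      _ = (B ^ 2) ^ (1 - π) * b ^ (D - β) * Real.exp A * l ^ (-π) * u ^ (-β) * l ^ (2 - σ) := by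
          rw [sub_eq_add_neg D β, Real.rpow_add hupos]
          -- The balance `δ u^D = l^(π - σ)` trades the noise level for a power of the logarithm.
          have h1 : l ^ (-π) * l ^ (2 - σ) = l ^ (π - σ) * l ^ (2 - 2 * π) := by
            rw [← Real.rpow_add hlpos, ← Real.rpow_add hlpos]
            congr 1
            ring
          linear_combination ((B ^ 2) ^ (1 - π) * b ^ (D + -β) * Real.exp A * u ^ (-β)) *
            (l ^ (2 - 2 * π) * huD - h1)
      _ ≤ _ := by
          refine mul_le_mul_of_nonneg_right (mul_le_mul_of_nonneg_right
            (mul_le_mul_of_nonneg_left (hlneg π hπ0) ?_) ?_) ?_ <;> positivity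
  calc _ ≤ _ := add_le_add T1 T2
    _ = _ := by ring

/-! ### Convergence of the derivative series and the error of the truncation method. -/

theorem norm_sum_smul_phiDeriv_le (r : ℕ) (x : ℕ × ℕ → ℝ) (S : Finset (ℕ × ℕ))
    (hS : ∀ i ∈ S, 1 ≤ i.1 ∧ 1 ≤ i.2) :
    ‖∑ i ∈ S, x i • phiDeriv r i.1 i.2‖ ≤
      4 * ∑ i ∈ S, indexProd i ^ (2 * (r : ℝ) + 1 / 2) * |x i| := by
  rw [Finset.mul_sum]
  refine norm_sum_le_of_le S fun i hi => ?_
  rw [norm_smul, Real.norm_eq_abs]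
  calc _ ≤ |x i| * (4 * indexProd i ^ (2 * (r : ℝ) + 1 / 2)) := by
        gcongr
        exact norm_phiDeriv_le r (hS i hi).1 (hS i hi).2
    _ = _ := by ring

theorem summable_norm_mixedDerivTerm {r : ℕ} (hr : 1 ≤ r) {s μ : ℝ} (hs : 1 ≤ s)
    (hμ : 2 * (r : ℝ) - 1 / s + 3 / 2 < μ) {f : ℝ × ℝ → ℝ} (hf : f ∈ smoothClass s μ) :
    Summable fun kj => ‖mixedDerivTerm r f kj‖ := by
  have hε : 0 < μ - (2 * (r : ℝ) + 1 / 2) - 1 + 1 / s := by linarith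
  obtain ⟨C, hC⟩ : ∃ C, ∀ S : Finset (ℕ × ℕ), (∀ i ∈ S, 1 ≤ i.1 ∧ 1 ≤ i.2) →
      ∑ i ∈ S, indexProd i ^ (2 * (r : ℝ) + 1 / 2) * |coeff f i.1 i.2| ≤ C :=
    -- The largest admissible `ε` and `N = 1` give a bound independent of `S`.
    ⟨_, fun S hS => sum_indexProd_mul_coeff_le hs hε le_rfl one_pos hf S hS fun i hi =>
      one_le_indexProd (hS i hi).1 (hS i hi).2⟩
  refine summable_of_sum_le (fun _ => norm_nonneg _) (c := 4 * C) fun T => ?_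
  have hT : ∀ i ∈ T.map (Function.Embedding.subtype _), 1 ≤ i.1 ∧ 1 ≤ i.2 := by
    intro i hi
    obtain ⟨j, _, rfl⟩ := Finset.mem_map.1 hi
    exact ⟨hr.trans j.2.1, hr.trans j.2.2⟩
  have h := hC _ hT
  calc _ ≤ ∑ i ∈ T, 4 * (indexProd i.1 ^ (2 * (r : ℝ) + 1 / 2) * |coeff f i.1.1 i.1.2|) := by
        refine Finset.sum_le_sum fun i _ => ?_
        rw [mixedDerivTerm, norm_smul, Real.norm_eq_abs]
        calc _ ≤ |coeff f i.1.1 i.1.2| * (4 * indexProd i.1 ^ (2 * (r : ℝ) + 1 / 2)) := by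
              gcongr
              exact norm_phiDeriv_le r (hr.trans i.2.1) (hr.trans i.2.2)
          _ = _ := by ring
    _ ≤ _ := by
        rw [← Finset.mul_sum]
        refine mul_le_mul_of_nonneg_left ?_ (by norm_num)
        rw [Finset.sum_map] at h
        exact h

/-- The bounds `k, j < n` are automatic: if one index is at least `n` and the other at least `r`,
the product is at least `r n`. -/
theorem mem_hyperbolicCross {r n : ℕ} {i : ℕ × ℕ} :
    i ∈ hyperbolicCross r n ↔ r ≤ i.1 ∧ r ≤ i.2 ∧ i.1 * i.2 < r * n := by
  simp only [hyperbolicCross, Finset.mem_filter, Finset.mem_product, Finset.mem_Ico]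
  constructor
  · rintro ⟨⟨⟨h1, _⟩, h2, _⟩, h3⟩
    exact ⟨h1, h2, h3⟩
  · rintro ⟨h1, h2, h3⟩
    refine ⟨⟨⟨h1, ?_⟩, h2, ?_⟩, h3⟩
    · by_contra! hc
      have := Nat.mul_le_mul h2 hc
      rw [mul_comm i.2] at this
      omega
    · by_contra! hc
      have := Nat.mul_le_mul h1 hc
      omega

/-- Passing to the limit along finite sets containing `U` reduces the infinite tail to finite sums
off `U`. -/
theorem norm_mixedDeriv_sub_sum_le {r : ℕ} {f : ℝ × ℝ → ℝ}
    (hf : Summable (mixedDerivTerm r f)) {U : Finset (ℕ × ℕ)} (hU : ∀ i ∈ U, r ≤ i.1 ∧ r ≤ i.2)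
    {E : ℝ} (hE : ∀ S : Finset (ℕ × ℕ), (∀ i ∈ S, r ≤ i.1 ∧ r ≤ i.2 ∧ i ∉ U) →
      ‖∑ i ∈ S, coeff f i.1 i.2 • phiDeriv r i.1 i.2‖ ≤ E) :
    ‖mixedDeriv r f - ∑ i ∈ U, coeff f i.1 i.2 • phiDeriv r i.1 i.2‖ ≤ E := by
  classical
  set e : Set.Ici (r, r) ↪ ℕ × ℕ := Function.Embedding.subtype _
  have hlim : Filter.Tendsto (fun T : Finset (Set.Ici (r, r)) =>
      ‖∑ i ∈ T, mixedDerivTerm r f i - ∑ i ∈ U, coeff f i.1 i.2 • phiDeriv r i.1 i.2‖)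
      Filter.atTop
      (nhds ‖mixedDeriv r f - ∑ i ∈ U, coeff f i.1 i.2 • phiDeriv r i.1 i.2‖) :=
    ((hf.hasSum : Filter.Tendsto _ _ _).sub_const _).norm
  refine le_of_tendsto hlim ?_
  filter_upwards [Filter.eventually_ge_atTop (U.subtype (· ∈ Set.Ici (r, r)))] with T hT
  have h1 : ∑ i ∈ T, mixedDerivTerm r f i =
      ∑ i ∈ T.map e, coeff f i.1 i.2 • phiDeriv r i.1 i.2 := by
    rw [Finset.sum_map]
    rfl
  have h2 : U ⊆ T.map e := by
    intro i hi
    exact Finset.mem_map.2 ⟨⟨i, hU i hi⟩, hT (Finset.mem_subtype.2 hi), rfl⟩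
  rw [h1, ← Finset.sum_sdiff h2, add_sub_cancel_right]
  refine hE _ fun i hi => ?_
  obtain ⟨hi1, hi2⟩ := Finset.mem_sdiff.1 hi
  obtain ⟨j, _, rfl⟩ := Finset.mem_map.1 hi1
  exact ⟨j.2.1, j.2.2, hi2⟩

theorem norm_mixedDeriv_sub_truncation_le {r n : ℕ} (hr : 1 ≤ r) (hn : 1 ≤ n) {s μ : ℝ}
    (hs : 1 ≤ s) (hμ : 2 * (r : ℝ) - 1 / s + 3 / 2 < μ) {p : ℝ≥0∞} (hp : 1 ≤ p) {δ ε : ℝ}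
    (hδ : 0 ≤ δ) (hε : 0 < ε) (hεβ : ε ≤ μ - 2 * (r : ℝ) + 1 / s - 3 / 2) {f : ℝ × ℝ → ℝ}
    (hf : f ∈ smoothClass s μ) {g : ℕ × ℕ → ℝ} (hg : IsPerturbation p δ f g) :
    ‖mixedDeriv r f - truncation r n g‖ ≤
      4 * (((1 + 1 / ε) ^ 2) ^ (1 - 1 / s) *
          ((r : ℝ) * n) ^ (-(μ - 2 * (r : ℝ) + 1 / s - 3 / 2) + ε * (1 - 1 / s)) +
        δ * ((1 + 1 / ε) ^ 2) ^ (1 - recip p) *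
          ((r : ℝ) * n) ^ (2 * (r : ℝ) + 3 / 2 - recip p + ε * (1 - recip p))) := by
  obtain ⟨ξ, hξg, hξ⟩ := hg
  have hN : 0 < (r : ℝ) * n := by positivity
  have hcross : ∀ i ∈ hyperbolicCross r n, 1 ≤ i.1 ∧ 1 ≤ i.2 := fun i hi =>
    ⟨hr.trans (mem_hyperbolicCross.1 hi).1, hr.trans (mem_hyperbolicCross.1 hi).2.1⟩
  have htail : ‖mixedDeriv r f -
      ∑ i ∈ hyperbolicCross r n, coeff f i.1 i.2 • phiDeriv r i.1 i.2‖ ≤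
      4 * (((1 + 1 / ε) ^ 2) ^ (1 - 1 / s) *
          ((r : ℝ) * n) ^ (-(μ - 2 * (r : ℝ) + 1 / s - 3 / 2) + ε * (1 - 1 / s))) := by
    refine norm_mixedDeriv_sub_sum_le (summable_norm_mixedDerivTerm hr hs hμ hf).of_norm
      (fun i hi => ⟨(mem_hyperbolicCross.1 hi).1, (mem_hyperbolicCross.1 hi).2.1⟩)
      fun S hS => ?_
    have hS1 : ∀ i ∈ S, 1 ≤ i.1 ∧ 1 ≤ i.2 := fun i hi =>
      ⟨hr.trans (hS i hi).1, hr.trans (hS i hi).2.1⟩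
    refine (norm_sum_smul_phiDeriv_le r (fun i => coeff f i.1 i.2) S hS1).trans ?_
    have h := sum_indexProd_mul_coeff_le (α := 2 * (r : ℝ) + 1 / 2) hs hε (by linarith) hN hf S hS1
      fun i hi => ?_
    · rw [show μ - 2 * (r : ℝ) + 1 / s - 3 / 2 = μ - (2 * (r : ℝ) + 1 / 2) - 1 + 1 / s by ring]
      gcongr
    · obtain ⟨h1, h2, h3⟩ := hS i hi
      rw [mem_hyperbolicCross] at h3
      have h4 : r * n ≤ i.1 * i.2 := by
        by_contra! hc
        exact h3 ⟨h1, h2, hc⟩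
      unfold indexProd
      exact_mod_cast h4
  have hnoise : ‖∑ i ∈ hyperbolicCross r n, coeff f i.1 i.2 • phiDeriv r i.1 i.2 -
      truncation r n g‖ ≤ 4 * (δ * ((1 + 1 / ε) ^ 2) ^ (1 - recip p) *
          ((r : ℝ) * n) ^ (2 * (r : ℝ) + 3 / 2 - recip p + ε * (1 - recip p))) := by
    have h0 : ∑ i ∈ hyperbolicCross r n, coeff f i.1 i.2 • phiDeriv r i.1 i.2 -
        truncation r n g = ∑ i ∈ hyperbolicCross r n, ξ i • phiDeriv r i.1 i.2 := by
      rw [truncation, ← Finset.sum_sub_distrib]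
      refine Finset.sum_congr rfl fun i _ => ?_
      rw [hξg, sub_smul]
    rw [h0]
    refine (norm_sum_smul_phiDeriv_le r (fun i => ξ i) _ hcross).trans ?_
    have h := sum_indexProd_mul_perturbation_le (α := 2 * (r : ℝ) + 1 / 2) hp hδ hε (by positivity)
      hN ξ hξ _ hcross fun i hi => ?_
    · rw [show 2 * (r : ℝ) + 3 / 2 - recip p + ε * (1 - recip p) =
        2 * (r : ℝ) + 1 / 2 + (1 + ε) * (1 - recip p) by ring]
      gcongr
    · have h3 := (mem_hyperbolicCross.1 hi).2.2.le
      unfold indexProd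
      exact_mod_cast h3
  calc _ ≤ _ := norm_sub_le_norm_sub_add_norm_sub _ _ _
    _ ≤ _ := add_le_add htail hnoise
    _ = _ := by ring

theorem recip_nonneg (p : ℝ≥0∞) : 0 ≤ recip p := ENNReal.toReal_nonneg

theorem recip_le_one {p : ℝ≥0∞} (hp : 1 ≤ p) : recip p ≤ 1 := by
  rw [recip, one_div]
  exact ENNReal.toReal_le_of_le_ofReal zero_le_one (by simpa using hp)

end LegendreDiff

theorem theorem2 (r : ℕ) (hr : 1 ≤ r) (s μ : ℝ) (hs : 1 ≤ s)
    (hμ : 2 * (r : ℝ) - 1 / s + 3 / 2 < μ) (p : ℝ≥0∞) (hp : 1 ≤ p) :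
    (∀ f ∈ LegendreDiff.smoothClass s μ, Summable (LegendreDiff.mixedDerivTerm r f)) ∧
    ∀ a b δ₀ : ℝ, 0 < a → 0 < b → 0 < δ₀ → δ₀ < 1 →
      ∃ c : ℝ, 0 < c ∧
        ∀ δ : ℝ, 0 < δ → δ ≤ δ₀ →
        ∀ n : ℕ,
          a * (δ⁻¹ * Real.log (1 / δ) ^ (LegendreDiff.recip p - 1 / s)) ^
              (1 / (μ - LegendreDiff.recip p + 1 / s)) ≤ (n : ℝ) →
          (n : ℝ) ≤ b * (δ⁻¹ * Real.log (1 / δ) ^ (LegendreDiff.recip p - 1 / s)) ^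
              (1 / (μ - LegendreDiff.recip p + 1 / s)) →
        ∀ f ∈ LegendreDiff.smoothClass s μ,
        ∀ g : ℕ × ℕ → ℝ, LegendreDiff.IsPerturbation p δ f g →
          ‖LegendreDiff.mixedDeriv r f - LegendreDiff.truncation r n g‖ ≤
            c * (δ * Real.log (1 / δ) ^ (1 / s - LegendreDiff.recip p)) ^
                ((μ - 2 * (r : ℝ) + 1 / s - 3 / 2) / (μ - LegendreDiff.recip p + 1 / s)) *
              Real.log (1 / δ) ^ (2 - 1 / s) := by
  refine ⟨fun f hf => (LegendreDiff.summable_norm_mixedDerivTerm hr hs hμ hf).of_norm, ?_⟩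
  intro a b δ₀ ha hb hδ₀ hδ₀'
  have hr' : (1 : ℝ) ≤ r := by exact_mod_cast hr
  have hp0 := LegendreDiff.recip_nonneg p
  have hp1 := LegendreDiff.recip_le_one hp
  have hs0 : 0 ≤ 1 / s := by positivity
  have hs1 : 1 / s ≤ 1 := by rw [div_le_one (by linarith)]; exact hs
  -- The cutoff for `k j` is `N = r n`, hence the factor `r` on `a` and `b`.
  obtain ⟨c, hc, H⟩ := LegendreDiff.exists_rate_const
    (D := μ - LegendreDiff.recip p + 1 / s) (β := μ - 2 * (r : ℝ) + 1 / s - 3 / 2)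
    (a := r * a) (b := r * b) (by linarith) (by linarith) hs0 hs1 hp0 hp1
    (by positivity) (by positivity) hδ₀ hδ₀'
  refine ⟨4 * c, by positivity, fun δ hδ hδδ n han hnb f hf g hg => ?_⟩
  have hlog : 0 < Real.log (1 / δ) := Real.log_pos (by rw [lt_div_iff₀ hδ]; linarith)
  -- The lower bound on `n` is positive because `log (1/δ) > 0`.
  have hn : 1 ≤ n := by
    have h : (0 : ℝ) < n := lt_of_lt_of_le (by positivity) han
    exact_mod_cast h
  have hn' : (1 : ℝ) ≤ n := by exact_mod_cast hn
  obtain ⟨ε, hε, hεβ, hle⟩ := H δ hδ hδδ (r * n) (one_le_mul_of_one_le_of_one_le hr' hn')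
    (by rw [mul_assoc]; gcongr) (by rw [mul_assoc]; gcongr)
  refine (LegendreDiff.norm_mixedDeriv_sub_truncation_le hr hn hs hμ hp hδ.le hε hεβ hf hg).trans ?_
  rw [show μ - LegendreDiff.recip p + 1 / s - (μ - 2 * (r : ℝ) + 1 / s - 3 / 2) =
    2 * (r : ℝ) + 3 / 2 - LegendreDiff.recip p by ring] at hle
  calc _ ≤ _ := mul_le_mul_of_nonneg_left hle (by norm_num)
    _ = _ := by ring
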